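/- Let $k$ be a field, $0\le d\le n$, and let $\mathrm{Gr}(d,n)$ be the Grassmannian of $d$-dimensional subspaces of the space $k^{1\times n}$ of row vectors, on which $\mathrm{GL}_n$ acts by $g\cdot v=vg^{\mathrm{tr}}$; varieties over $k$ are described by their points over an algebraically closed extension $K\supseteq k$ (with $K=k$ if $k$ is algebraically closed), with the $k$-Zariski topology and the functions regular over $k$. Let $I=\{i_1<\dots<i_d\}$ and $J=\{j_1<\dots<j_d\}$ be subsets of $\{1,\dots,n\}$. Write $[X]$ for the row span of a matrix $X$, $e_I$ for the matrix whose rows are the standard basis vectors with indices $i_1,\dots,i_d$, and $B,B^-\subset\mathrm{GL}_n$ for the upper and lower triangular matrices. Let $R_{I,J}=B^-[e_I]\cap B[e_J]\subset\mathrm{Gr}(d,n)$ be the open Richardson variety, and for a permutation $w\in S_d$ let $$R_{I,J}^w=\{[X]\in R_{I,J}\;:\;X_I^{-1}X_J\in \mathbf B w\mathbf B\},$$ a locally closed subset with its reduced structure. Here $X_I,X_J$ are the $d\times d$ submatrices of columns of $X$ indexed by $I$ and $J$, $\mathbf B\subset\mathrm{GL}_d$ is the group of upper triangular matrices, and $w$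 is identified with the permutation matrix having entries $1$ at the positions $(w(k),k)$. Assume that $i_{w(k)}\le j_k$ for all $k$, and that $w(k')=k$ whenever $i_k=j_{k'}$. Consider a $d\times n$ grid with rows numbered from top to bottom and columns from left to right, with a vertical line in column $j_k$ for each $k$, and, for each $k$, a strand which goes up in column $i_k$ from the bottom to position $(k,i_k)$ and from there horizontally to the right in row $k$. Mark the intersection points $(w(k),j_k)$, $k=1,\dots,d$. The associated Deodhar-type Fukaya diagram has the following nodes: - a $\mathbb G_m$-node at each marked point $(w(k),j_k)$ with $i_{w(k)}\ne j_k$; - an $\mathbb A^1$-node at each position $(k,l)$ with $i_k<l<j_{w^{-1}(k)}$ and $l\notin J$; - an $\mathbb A^1$-node at each intersection point of a vertical line with the horizontal part of a strand such that the marked point on the vertical line lies strictly above, and the marked point on the horizontal part lies strictly to the left of, the intersection point. Let $\alpha$ be the number of $\mathbb G_m$-nodes and $\beta$ the number of $\mathbb A^1$-nodes. Then there is an isomorphism of varieties over $k$ $$R_{I,J}^w\cong \mathbb G_m^\alpha\times\mathbb A^\beta .$$ -/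

import Mathlib

open scoped Matrix

/-! ### Varieties as spaces with functions

A variety over a field `k` is described by its points over an algebraically closed extension
`K` of `k`, together with the `k`-Zariski topology on this set of points and the `K`-valued
functions on open subsets that are regular over `k`. For `k = K` algebraically closed these are
the classical varieties over `k`. -/

/-- A topological space together with a notion of regular `K`-valued functions on its open
subsets. `IsRegularOn U f` is only used for open `U` and only depends on the restriction of `f`
to `U`. -/
structure SpaceWithFunctions (K : Type*) (X : Type*) where
  top : TopologicalSpace X
  IsRegularOn : Set X → (X → K) → Prop

namespace SpaceWithFunctions

/-- The (quasi-affine) structure on a set `X` of points of an affine space, the coordinates being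
`c s : X → K` for `s : σ`: the topology is generated by the nonvanishing loci of polynomials with
coefficients in `k`, and the regular functions are locally quotients of such polynomials. -/
def ofCoordinates (k : Type*) {K X σ : Type*} [Field k] [Field K] [Algebra k K]
    (c : σ → X → K) : SpaceWithFunctions K X where
  top := TopologicalSpace.generateFrom
    {D | ∃ q : MvPolynomial σ k, D = {x | MvPolynomial.aeval (fun s => c s x) q ≠ 0}}
  IsRegularOn U f := ∀ x ∈ U, ∃ p q : MvPolynomial σ k,
    MvPolynomial.aeval (fun s => c s x) q ≠ 0 ∧
    ∀ y ∈ U, MvPolynomial.aeval (fun s => c s y) q ≠ 0 →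
      f y = MvPolynomial.aeval (fun s => c s y) p / MvPolynomial.aeval (fun s => c s y) q

/-- The quotient structure along a map `π`: open subsets and regular functions are those whose
pullbacks along `π` are open, respectively regular. -/
def quotient {K X Y : Type*} (A : SpaceWithFunctions K X) (π : X → Y) :
    SpaceWithFunctions K Y where
  top := TopologicalSpace.coinduced π A.top
  IsRegularOn U f := A.IsRegularOn (π ⁻¹' U) (f ∘ π)

/-- The structure induced on a (locally closed) subset: the regular functions are locally
restrictions of regular functions on open subsets of the ambient space. -/
def restrict {K X : Type*} (A : SpaceWithFunctions K X) (S : Set X) :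
    SpaceWithFunctions K S where
  top := TopologicalSpace.induced Subtype.val A.top
  IsRegularOn U f := ∀ x ∈ U, ∃ (V : Set X) (g : X → K),
    A.top.IsOpen V ∧ x.1 ∈ V ∧ A.IsRegularOn V g ∧ ∀ y ∈ U, y.1 ∈ V → f y = g y.1

/-- Isomorphism: a homeomorphism which identifies the regular functions on all open subsets. -/
def Isomorphic {K X Y : Type*} (A : SpaceWithFunctions K X) (B : SpaceWithFunctions K Y) : Prop :=
  ∃ e : X ≃ Y,
    (∀ U : Set Y, A.top.IsOpen (e ⁻¹' U) ↔ B.top.IsOpen U) ∧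
    ∀ U : Set Y, B.top.IsOpen U → ∀ f : Y → K,
      (A.IsRegularOn (e ⁻¹' U) (f ∘ e) ↔ B.IsRegularOn U f)

end SpaceWithFunctions

/-- The variety `(𝔾ₘ)^α × 𝔸^β` over `k`, an open subvariety of affine space `𝔸^(α+β)`. -/
def torusTimesAffine (k K : Type*) [Field k] [Field K] [Algebra k K] (α β : ℕ) :
    SpaceWithFunctions K ((Fin α → Kˣ) × (Fin β → K)) :=
  SpaceWithFunctions.ofCoordinates k
    (Sum.elim (fun (a : Fin α) x => ((x.1 a : Kˣ) : K)) (fun (b : Fin β) x => x.2 b))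

/-! ### Grassmannians -/

/-- `d × n` matrices of full rank `d`, that is, with linearly independent rows. -/
abbrev FullRankMatrix (K : Type*) [Field K] (d n : ℕ) : Type _ :=
  {X : Matrix (Fin d) (Fin n) K // LinearIndependent K X.row}

/-- The points of the Grassmannian: `d`-dimensional subspaces of the space of row vectors. -/
abbrev Gr (K : Type*) [Field K] (d n : ℕ) : Type _ :=
  {W : Submodule K (Fin n → K) // Module.finrank K W = d}

/-- The row span `[X]` of a matrix `X` of full rank. -/
def rowSpan {K : Type*} [Field K] {d n : ℕ} (X : FullRankMatrix K d n) : Gr K d n :=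
  ⟨Submodule.span K (Set.range X.1.row), by
    simpa using finrank_span_eq_card X.2⟩

theorem rowSpan_surjective {K : Type*} [Field K] {d n : ℕ} :
    Function.Surjective (rowSpan : FullRankMatrix K d n → Gr K d n) := by
  rintro ⟨W, hW⟩
  have b := Module.finBasisOfFinrankEq K W hW
  refine ⟨⟨Matrix.of fun a => (b a : Fin n → K), ?_⟩, ?_⟩
  · exact b.linearIndependent.map' W.subtype (Submodule.ker_subtype W)
  · apply Subtype.ext
    have h : Set.range (Matrix.row (Matrix.of fun a => (b a : Fin n → K)))
        = W.subtype '' Set.range b := by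
      rw [← Set.range_comp]; rfl
    change Submodule.span K (Set.range (Matrix.row (Matrix.of fun a => (b a : Fin n → K)))) = W
    rw [h, Submodule.span_image, b.span_eq, Submodule.map_subtype_top]

/-- The Grassmannian as a variety over `k`: the quotient of the open set of full rank matrices in
the affine space of `d × n` matrices by the action of `GL_d`, via the row span map. -/
def grassmannian (k K : Type*) [Field k] [Field K] [Algebra k K] (d n : ℕ) :
    SpaceWithFunctions K (Gr K d n) :=
  (SpaceWithFunctions.ofCoordinates k
    (fun (s : Fin d × Fin n) (X : FullRankMatrix K d n) => X.1 s.1 s.2)).quotient rowSpan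

/-- The Borel subgroup of upper triangular matrices. -/
def upperBorel (K : Type*) [Field K] (m : ℕ) : Set (GL (Fin m) K) :=
  {g | ∀ a b, b < a → g.1 a b = 0}

/-- The opposite Borel subgroup of lower triangular matrices. -/
def lowerBorel (K : Type*) [Field K] (m : ℕ) : Set (GL (Fin m) K) :=
  {g | ∀ a b, a < b → g.1 a b = 0}

/-- The action of `GL_n` on subspaces of the space of row vectors, induced by `g • v = v gᵀ`. -/
def glTranslate {K : Type*} [Field K] {n : ℕ} (g : GL (Fin n) K)
    (W : Submodule K (Fin n → K)) : Submodule K (Fin n → K) :=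
  W.map (Matrix.vecMulLinear (g.1)ᵀ)

/-- The coordinate subspace `[e_I]`, where `i` enumerates `I` increasingly. -/
def coordinateSubspace (K : Type*) [Field K] {d n : ℕ} (i : Fin d ↪o Fin n) :
    Submodule K (Fin n → K) :=
  Submodule.span K (Set.range fun a => (Pi.single (i a) 1 : Fin n → K))

/-- The Bruhat cell `Z_I^+ = B · [e_I]`. -/
def bruhatCellPos (K : Type*) [Field K] {d n : ℕ} (i : Fin d ↪o Fin n) : Set (Gr K d n) :=
  {W | ∃ g ∈ upperBorel K n, W.1 = glTranslate g (coordinateSubspace K i)}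

/-- The opposite Bruhat cell `Z_I^- = B^- · [e_I]`. -/
def bruhatCellNeg (K : Type*) [Field K] {d n : ℕ} (i : Fin d ↪o Fin n) : Set (Gr K d n) :=
  {W | ∃ g ∈ lowerBorel K n, W.1 = glTranslate g (coordinateSubspace K i)}

/-- The open Richardson variety `R_{I,J} = Z_I^- ∩ Z_J^+`. -/
def openRichardson (K : Type*) [Field K] {d n : ℕ} (i j : Fin d ↪o Fin n) : Set (Gr K d n) :=
  bruhatCellNeg K i ∩ bruhatCellPos K j

/-! ### Base change and the Deodhar-type decomposition -/

/-- The base change `W = [X] ↦ (X_I)⁻¹ X_J`, where `X_I`, `X_J` are the submatrices of the columns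
in `I`, `J`. It does not depend on the choice of `X`, see `baseChange_rowSpan`. On the open
Richardson variety, `X_I` and `X_J` are invertible. -/
noncomputable def baseChange {K : Type*} [Field K] {d n : ℕ} (i j : Fin d ↪o Fin n)
    (W : Gr K d n) : Matrix (Fin d) (Fin d) K :=
  let X : FullRankMatrix K d n := (rowSpan_surjective W).choose
  (X.1.submatrix id i)⁻¹ * X.1.submatrix id j

theorem baseChange_rowSpan {K : Type*} [Field K] {d n : ℕ} (i j : Fin d ↪o Fin n)
    (X : FullRankMatrix K d n) :
    baseChange i j (rowSpan X) = (X.1.submatrix id i)⁻¹ * X.1.submatrix id j := by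
  have hY := (rowSpan_surjective (rowSpan X)).choose_spec
  unfold baseChange
  set Y := (rowSpan_surjective (rowSpan X)).choose
  have hs : Submodule.span K (Set.range Y.1.row) = Submodule.span K (Set.range X.1.row) :=
    congrArg Subtype.val hY
  have key : ∀ A B : FullRankMatrix K d n,
      Submodule.span K (Set.range A.1.row) = Submodule.span K (Set.range B.1.row) →
      ∃ g : Matrix (Fin d) (Fin d) K, A.1 = g * B.1 := by
    intro A B h
    have hm : ∀ a, ∃ c : Fin d → K, ∑ b, c b • B.1.row b = A.1.row a := by
      intro a
      rw [← Submodule.mem_span_range_iff_exists_fun, ← h]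
      exact Submodule.subset_span ⟨a, rfl⟩
    choose c hc using hm
    refine ⟨Matrix.of c, ?_⟩
    ext a l
    have := congrFun (hc a) l
    simp only [Finset.sum_apply, Pi.smul_apply, smul_eq_mul, Matrix.row] at this
    rw [Matrix.mul_apply, ← this]
    rfl
  obtain ⟨g, hg⟩ := key Y X hs
  obtain ⟨g', hg'⟩ := key X Y hs.symm
  have hgg : g' * g = 1 := by
    have h1 : (g' * g) * X.1 = (1 : Matrix (Fin d) (Fin d) K) * X.1 := by rw [Matrix.mul_assoc, ← hg, ← hg', Matrix.one_mul]
    have hinj := Matrix.vecMul_injective_iff.mpr X.2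
    ext a b
    exact congrFun (hinj (funext fun l => congrFun (congrFun h1 a) l)) b
  have hsub : ∀ f : Fin d ↪o Fin n, Y.1.submatrix id f = g * X.1.submatrix id f := by
    intro f
    rw [hg]
    rfl
  have hinv : g⁻¹ = g' := Matrix.inv_eq_left_inv hgg
  simp only [hsub, Matrix.mul_inv_rev, hinv]
  rw [Matrix.mul_assoc, ← Matrix.mul_assoc g', hgg, Matrix.one_mul]

/-- The permutation matrix of `w`, sending the `b`-th basis vector to the `w(b)`-th. -/
def weylMatrix (K : Type*) [Field K] {d : ℕ} (w : Equiv.Perm (Fin d)) :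
    Matrix (Fin d) (Fin d) K :=
  Matrix.of fun a b => if a = w b then 1 else 0

/-- The Bruhat double coset `B w B` in `GL_d`. -/
def bruhatDoubleCoset (K : Type*) [Field K] {d : ℕ} (w : Equiv.Perm (Fin d)) :
    Set (Matrix (Fin d) (Fin d) K) :=
  {A | ∃ b ∈ upperBorel K d, ∃ b' ∈ upperBorel K d, A = b.1 * weylMatrix K w * b'.1}

/-- The part of the open Richardson variety `R_{I,J}` labelled by `w` in the Deodhar-type
decomposition: the preimage of `B w B` under base change. -/
def deodharStratum (K : Type*) [Field K] {d n : ℕ} (i j : Fin d ↪o Fin n)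
    (w : Equiv.Perm (Fin d)) : Set (Gr K d n) :=
  {W | W ∈ openRichardson K i j ∧ baseChange i j W ∈ bruhatDoubleCoset K w}

/-! ### Fukaya diagrams

The Fukaya diagram of shape `(I, J)` is drawn on a `d × n` grid, with rows counted from top to
bottom and columns from left to right. For each `k` there is a vertical line through the column
`j k`, and a strand which goes up in the column `i k` to the position `(k, i k)`, bends there, and
continues horizontally to the right in row `k`. The `I`-strand of `k` meets the vertical line of
`k'` if and only if `i k ≤ j k'`; their intersection point is `(k, j k')`. -/

/-- The permutations that label the strongly matched Fukaya diagrams of shape `(I, J)`. -/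
def strongMatchings {d n : ℕ} (i j : Fin d ↪o Fin n) : Set (Equiv.Perm (Fin d)) :=
  {w | (∀ k, i (w k) ≤ j k) ∧ ∀ k k', i k = j k' → k = w k'}

/-- The marked points of the matched Fukaya diagram of `w`: the intersection points of the
strands `i (w k)` and `j k`. -/
def markedPoints {d n : ℕ} (j : Fin d ↪o Fin n) (w : Equiv.Perm (Fin d)) : Set (Fin d × Fin n) :=
  {P | ∃ k, P = (w k, j k)}

/-- The `𝔾ₘ`-nodes: the marked points on strands starting at different points. -/
def gmNodes {d n : ℕ} (i j : Fin d ↪o Fin n) (w : Equiv.Perm (Fin d)) : Set (Fin d × Fin n) :=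
  {P | P ∈ markedPoints j w ∧ i P.1 ≠ P.2}

/-- The `𝔸¹`-nodes are of two types. First, the positions in each row `k` strictly between the
bend `(k, i k)` and the marked point of this row which do not lie on a vertical line. Second, the
intersection points of a vertical line and a horizontal line such that the marked point on the
vertical line is strictly above and the one on the horizontal line is strictly to the left of the
intersection point. -/
def affineNodes {d n : ℕ} (i j : Fin d ↪o Fin n) (w : Equiv.Perm (Fin d)) : Set (Fin d × Fin n) :=
  {P | i P.1 < P.2 ∧ (∃ m, (P.1, m) ∈ markedPoints j w ∧ P.2 < m) ∧ P.2 ∉ Set.range j} ∪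
  {P | P.2 ∈ Set.range j ∧ i P.1 ≤ P.2 ∧
    (∃ r, (r, P.2) ∈ markedPoints j w ∧ r < P.1) ∧ ∃ m, (P.1, m) ∈ markedPoints j w ∧ m < P.2}

/-! Each point of the stratum has exactly one representing matrix `X` in a normal form, and the
nodes are the free entries of that form.

Put `j' = j ∘ w⁻¹`. Membership in `B⁻[e_I]` gives a representative with `X_I` upper triangular, and
upper triangular row operations preserve this. The condition on `X_I⁻¹ X_J` lets such an operation
bring the submatrix `v` of columns `j'` into `w B w⁻¹`. This group is the product of its upper
triangular and its lower unitriangular elements, so a further operation makes `v` lower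
unitriangular as well as triangular in the order of `j'` (`exists_upper_mul_eq_lower`). Membership
in `B[e_J]` then says `X = v * C`, with row `c` of `C` zero to the right of `j' c`.

For a column `l` outside `J`, the rows `a` with `l ≤ j' a` determine column `l` of `C` by a
unitriangular system, hence also the remaining rows (`completion`). What stays free are the pivots
`X a (i a)` (nonzero, and equal to 1 if `i a = j' a`), the entries outside `J` between pivot and
marked point, and the entries of `v` allowed by both triangularities: these are the nodes
(`IsNormalForm.eq_completion_nodeMatrix`).

The parametrization is polynomial because the system has determinant 1. Its inverse is regular
because row `a` of the normal form of any representative `Y` is row `a` of `M⁻¹ * Y`, with `M` the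
columns `mixedColumns i j' a` of `Y`; this is invariant under `GL_d`, and its denominators do not
vanish on the stratum. `isomorphic_restrict_quotient` turns this into an isomorphism. -/

/-! ### Zariski structures and a criterion for isomorphism -/

namespace SpaceWithFunctions

variable {k K X Y T σ τ : Type*} [Field k] [Field K] [Algebra k K]

/-- The nonvanishing loci of polynomials form a basis of the Zariski topology. -/
theorem isOpen_ofCoordinates_iff (c : σ → X → K) (U : Set X) :
    (ofCoordinates k c).top.IsOpen U ↔ ∀ x ∈ U, ∃ q : MvPolynomial σ k,
      MvPolynomial.aeval (fun s => c s x) q ≠ 0 ∧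
        ∀ y, MvPolynomial.aeval (fun s => c s y) q ≠ 0 → y ∈ U := by
  constructor
  · intro h
    induction h with
    | basic D hD =>
      obtain ⟨q, rfl⟩ := hD
      exact fun x hx => ⟨q, hx, fun y hy => hy⟩
    | univ => exact fun x _ => ⟨1, by simp, fun y _ => trivial⟩
    | inter U V _ _ hU hV =>
      rintro x ⟨hxU, hxV⟩
      obtain ⟨p, hp, hpU⟩ := hU x hxU
      obtain ⟨q, hq, hqV⟩ := hV x hxV
      refine ⟨p * q, by simpa using ⟨hp, hq⟩, fun y hy => ?_⟩
      rw [map_mul] at hy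
      exact ⟨hpU y (left_ne_zero_of_mul hy), hqV y (right_ne_zero_of_mul hy)⟩
    | sUnion 𝒰 _ h =>
      rintro x ⟨U, hU, hxU⟩
      obtain ⟨q, hq, hqU⟩ := h U hU x hxU
      exact ⟨q, hq, fun y hy => ⟨U, hU, hqU y hy⟩⟩
  · intro h
    choose! q hq hqU using h
    have hU : U = ⋃₀ {D | ∃ x ∈ U, D = {y | MvPolynomial.aeval (fun s => c s y) (q x) ≠ 0}} := by
      ext y
      constructor
      · exact fun hy => ⟨_, ⟨y, hy, rfl⟩, hq y hy⟩
      · rintro ⟨_, ⟨x, hx, rfl⟩, hy⟩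
        exact hqU x hx y hy
    rw [hU]
    refine TopologicalSpace.GenerateOpen.sUnion _ ?_
    rintro _ ⟨x, _, rfl⟩
    exact TopologicalSpace.GenerateOpen.basic _ ⟨q x, rfl⟩

/-- A polynomial in functions of the form `p / Q ^ N` is again of this form. -/
theorem exists_aeval_eq_div_pow (v : X → σ → K) (F : τ → X → K) (Q : MvPolynomial σ k)
    (hF : ∀ u, ∃ (p : MvPolynomial σ k) (N : ℕ), ∀ x, MvPolynomial.aeval (v x) Q ≠ 0 →
      F u x = MvPolynomial.aeval (v x) p / MvPolynomial.aeval (v x) Q ^ N)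
    (r : MvPolynomial τ k) :
    ∃ (p : MvPolynomial σ k) (N : ℕ), ∀ x, MvPolynomial.aeval (v x) Q ≠ 0 →
      MvPolynomial.aeval (fun u => F u x) r
        = MvPolynomial.aeval (v x) p / MvPolynomial.aeval (v x) Q ^ N := by
  induction r using MvPolynomial.induction_on with
  | C a => exact ⟨MvPolynomial.C a, 0, fun x _ => by simp⟩
  | add p q hp hq =>
    obtain ⟨p', M, hp⟩ := hp
    obtain ⟨q', N, hq⟩ := hq
    refine ⟨p' * Q ^ N + Q ^ M * q', M + N, fun x hx => ?_⟩
    rw [map_add, hp x hx, hq x hx, div_add_div _ _ (pow_ne_zero _ hx) (pow_ne_zero _ hx), pow_add]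
    simp
  | mul_X p u hp =>
    obtain ⟨p', M, hp⟩ := hp
    obtain ⟨q', N, hq⟩ := hF u
    refine ⟨p' * q', M + N, fun x hx => ?_⟩
    rw [map_mul, hp x hx, MvPolynomial.aeval_X, hq x hx, div_mul_div_comm, pow_add, map_mul]

/-- A criterion for a subset of a quotient of a quasi-affine variety to be isomorphic to a
quasi-affine variety: the inverse of the isomorphism lifts to a polynomial map, and the isomorphism
itself is given by functions on the quotient whose denominators do not vanish on the subset. -/
theorem isomorphic_restrict_quotient (c : σ → X → K) (c' : τ → T → K) (π : X → Y)
    (S : Set Y) (e : S ≃ T) (ψ : T → X)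
    (hψ : ∀ t, π (ψ t) = (e.symm t).1) (P : σ → MvPolynomial τ k)
    (hP : ∀ s t, c s (ψ t) = MvPolynomial.aeval (fun u => c' u t) (P s))
    (F : τ → Y → K) (hF : ∀ u (x : S), F u x.1 = c' u (e x))
    (Q : MvPolynomial σ k) (D : Set Y)
    (hD : ∀ x, π x ∈ D ↔ MvPolynomial.aeval (fun s => c s x) Q ≠ 0) (hSD : S ⊆ D)
    (hFQ : ∀ u, ∃ (p : MvPolynomial σ k) (N : ℕ),
      ∀ x, MvPolynomial.aeval (fun s => c s x) Q ≠ 0 → F u (π x) =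
        MvPolynomial.aeval (fun s => c s x) p / MvPolynomial.aeval (fun s => c s x) Q ^ N) :
    (((ofCoordinates k c).quotient π).restrict S).Isomorphic (ofCoordinates k c') := by
  have hlift : ∀ r : MvPolynomial τ k, ∃ (p : MvPolynomial σ k) (N : ℕ),
      ∀ x, MvPolynomial.aeval (fun s => c s x) Q ≠ 0 →
        MvPolynomial.aeval (fun u => F u (π x)) r =
          MvPolynomial.aeval (fun s => c s x) p / MvPolynomial.aeval (fun s => c s x) Q ^ N :=
    exists_aeval_eq_div_pow (fun x s => c s x) (fun u x => F u (π x)) Q hFQ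
  have hopen : ∀ r : MvPolynomial τ k, ((ofCoordinates k c).quotient π).top.IsOpen
      {y | y ∈ D ∧ MvPolynomial.aeval (fun u => F u y) r ≠ 0} := by
    intro r
    obtain ⟨p, N, hp⟩ := hlift r
    change (ofCoordinates k c).top.IsOpen (π ⁻¹' _)
    rw [isOpen_ofCoordinates_iff]
    rintro x ⟨hxD, hxr⟩
    rw [hD] at hxD
    -- The factor `Q` keeps the basic open set inside `D`, where the formula for the pulled back
    -- functions is valid.
    refine ⟨p * Q, ?_, fun y hy => ?_⟩
    · rw [hp x hxD] at hxr
      rw [map_mul]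
      exact mul_ne_zero (fun h => hxr (by rw [h, zero_div])) hxD
    · rw [map_mul] at hy
      have hyD := right_ne_zero_of_mul hy
      refine ⟨(hD y).2 hyD, ?_⟩
      rw [hp y hyD]
      exact div_ne_zero (left_ne_zero_of_mul hy) (pow_ne_zero _ hyD)
  have haeval : ∀ (x : S) (r : MvPolynomial τ k), MvPolynomial.aeval (fun u => F u x.1) r
      = MvPolynomial.aeval (fun u => c' u (e x)) r := by
    intro x r
    simp only [hF]
  have hpull : ∀ (t : T) (p : MvPolynomial σ k), MvPolynomial.aeval (fun s => c s (ψ t)) p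
      = MvPolynomial.aeval (fun u => c' u t) (MvPolynomial.bind₁ P p) := by
    intro t p
    rw [MvPolynomial.aeval_bind₁]
    simp only [hP]
  have hcont : ∀ V : Set Y, ((ofCoordinates k c).quotient π).top.IsOpen V →
      (ofCoordinates k c').top.IsOpen {t | (e.symm t).1 ∈ V} := by
    intro V hV
    rw [isOpen_ofCoordinates_iff]
    intro t ht
    obtain ⟨q, hq, hqV⟩ := (isOpen_ofCoordinates_iff c _).1 hV (ψ t) (by
      change π (ψ t) ∈ V
      rwa [hψ])
    refine ⟨MvPolynomial.bind₁ P q, by rwa [← hpull], fun t' ht' => ?_⟩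
    have := hqV (ψ t') (by rwa [hpull])
    change π (ψ t') ∈ V at this
    rwa [hψ] at this
  refine ⟨e, fun U => ⟨?_, fun hU => ?_⟩, fun U hU f => ⟨fun hf t ht => ?_, fun hf x hx => ?_⟩⟩
  · rintro ⟨V, hV, hVU⟩
    convert hcont V hV using 1
    ext t
    have := Set.ext_iff.1 hVU (e.symm t)
    simpa using this.symm
  · rw [isOpen_ofCoordinates_iff] at hU
    choose! q hq hqU using hU
    refine ⟨⋃ t ∈ U, {y | y ∈ D ∧ MvPolynomial.aeval (fun u => F u y) (q t) ≠ 0}, ?_, ?_⟩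
    · let _ := ((ofCoordinates k c).quotient π).top
      exact isOpen_biUnion fun t _ => hopen (q t)
    · ext x
      simp only [Set.mem_preimage, Set.mem_iUnion, Set.mem_ofPred_eq, haeval]
      constructor
      · rintro ⟨t, ht, _, hx⟩
        exact hqU t ht _ hx
      · exact fun hx => ⟨e x, hx, hSD x.2, hq _ hx⟩
  · obtain ⟨V, g, hV, htV, hg, hfg⟩ := hf (e.symm t) (by simpa using ht)
    obtain ⟨r, hr, hrV⟩ := (isOpen_ofCoordinates_iff c' _).1 (hcont V hV) t htV
    obtain ⟨p, q, hq, hpq⟩ := hg (ψ t) (by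
      change π (ψ t) ∈ V
      rwa [hψ])
    -- Expanding the fraction by `r` confines it to the neighbourhood on which `f` agrees with the
    -- ambient function `g`.
    refine ⟨MvPolynomial.bind₁ P p * r, MvPolynomial.bind₁ P q * r, ?_, fun t' ht' hqr => ?_⟩
    · rw [map_mul, ← hpull]
      exact mul_ne_zero hq hr
    · rw [map_mul, ← hpull] at hqr
      have hr' := right_ne_zero_of_mul hqr
      have hV' : (e.symm t').1 ∈ V := hrV t' hr'
      have h1 := hfg (e.symm t') (by simpa using ht') hV'
      have h2 := hpq (ψ t') (by
        change π (ψ t') ∈ V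
        rwa [hψ]) (left_ne_zero_of_mul hqr)
      simp only [Function.comp_apply, Equiv.apply_symm_apply, hψ] at h1 h2
      rw [h1, h2, map_mul, map_mul, hpull, hpull, mul_div_mul_right _ _ hr']
  · obtain ⟨p, q, hq, hpq⟩ := hf (e x) hx
    refine ⟨{y | y ∈ D ∧ MvPolynomial.aeval (fun u => F u y) q ≠ 0},
      fun y => MvPolynomial.aeval (fun u => F u y) p / MvPolynomial.aeval (fun u => F u y) q,
      hopen q, ⟨hSD x.2, by rwa [haeval]⟩, ?_, ?_⟩
    · obtain ⟨p', M, hp'⟩ := hlift p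
      obtain ⟨q', N, hq'⟩ := hlift q
      rintro z ⟨hzD, hzq⟩
      rw [hD] at hzD
      refine ⟨p' * Q ^ N, q' * Q ^ M, ?_, ?_⟩
      · rw [hq' z hzD] at hzq
        rw [map_mul, map_pow]
        exact mul_ne_zero (fun h => hzq (by rw [h, zero_div])) (pow_ne_zero _ hzD)
      · rintro y ⟨hyD, _⟩ _
        rw [hD] at hyD
        rw [Function.comp_apply, hp' y hyD, hq' y hyD, div_div_div_eq, map_mul, map_mul, map_pow,
          map_pow, mul_comm (_ ^ M)]
    · rintro y hyU ⟨_, hyq⟩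
      rw [haeval] at hyq
      simp only [Function.comp_apply, haeval]
      exact hpq (e y) hyU hyq

end SpaceWithFunctions

/-! ### Matrices triangular in an arbitrary order of the indices -/

section Triangular

variable {m α R : Type*} [Fintype m] [DecidableEq m] [LinearOrder α]

theorem Matrix.BlockTriangular.det_of_injective [CommRing R] {M : Matrix m m R} {b : m → α}
    (hM : M.BlockTriangular b) (hb : Function.Injective b) : M.det = ∏ a, M a a := by
  let _ : LinearOrder m := LinearOrder.lift' b hb
  refine Matrix.det_of_isUpperTriangular fun a c hac => hM ?_
  exact hac

theorem Matrix.BlockTriangular.det_ne_zero_iff [Field R] {M : Matrix m m R} {b : m → α}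
    (hM : M.BlockTriangular b) (hb : Function.Injective b) : M.det ≠ 0 ↔ ∀ a, M a a ≠ 0 := by
  rw [hM.det_of_injective hb, Finset.prod_ne_zero_iff]
  simp

theorem Matrix.BlockTriangular.inv_of_det_ne_zero [Field R] {M : Matrix m m R} {b : m → α}
    (hM : M.BlockTriangular b) (h : M.det ≠ 0) : (M⁻¹).BlockTriangular b := by
  let _ := Matrix.invertibleOfIsUnitDet M h.isUnit
  exact Matrix.blockTriangular_inv_of_blockTriangular hM

end Triangular

/-! ### Row spans and changes of representative -/

section RowSpan

variable {K : Type*} [Field K] {d n : ℕ}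

theorem Matrix.span_row_mul_le (g : Matrix (Fin d) (Fin d) K) (X : Matrix (Fin d) (Fin n) K) :
    Submodule.span K (Set.range (g * X).row) ≤ Submodule.span K (Set.range X.row) := by
  rw [Submodule.span_le]
  rintro _ ⟨a, rfl⟩
  rw [SetLike.mem_coe, Submodule.mem_span_range_iff_exists_fun]
  refine ⟨g a, ?_⟩
  ext l
  simp [Matrix.row, Matrix.mul_apply]

theorem Matrix.span_row_mul {g : Matrix (Fin d) (Fin d) K} (hg : g.det ≠ 0)
    (X : Matrix (Fin d) (Fin n) K) :
    Submodule.span K (Set.range (g * X).row) = Submodule.span K (Set.range X.row) := by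
  refine le_antisymm (Matrix.span_row_mul_le g X) ?_
  have := Matrix.span_row_mul_le g⁻¹ (g * X)
  rwa [← Matrix.mul_assoc, Matrix.nonsing_inv_mul g hg.isUnit, Matrix.one_mul] at this

theorem Matrix.exists_mul_of_span_row_le {A B : Matrix (Fin d) (Fin n) K}
    (h : Submodule.span K (Set.range A.row) ≤ Submodule.span K (Set.range B.row)) :
    ∃ g : Matrix (Fin d) (Fin d) K, A = g * B := by
  have hm : ∀ a, ∃ c : Fin d → K, ∑ b, c b • B.row b = A.row a := by
    intro a
    rw [← Submodule.mem_span_range_iff_exists_fun]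
    exact h (Submodule.subset_span ⟨a, rfl⟩)
  choose c hc using hm
  refine ⟨Matrix.of c, ?_⟩
  ext a l
  have := congrFun (hc a) l
  simp only [Finset.sum_apply, Pi.smul_apply, smul_eq_mul, Matrix.row] at this
  rw [Matrix.mul_apply, ← this]
  rfl

theorem exists_mul_of_rowSpan_eq {A B : FullRankMatrix K d n} (h : rowSpan A = rowSpan B) :
    ∃ g : Matrix (Fin d) (Fin d) K, g.det ≠ 0 ∧ A.1 = g * B.1 := by
  have hs : Submodule.span K (Set.range A.1.row) = Submodule.span K (Set.range B.1.row) :=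
    congrArg Subtype.val h
  obtain ⟨g, hg⟩ := Matrix.exists_mul_of_span_row_le hs.le
  obtain ⟨g', hg'⟩ := Matrix.exists_mul_of_span_row_le hs.ge
  refine ⟨g, fun h0 => ?_, hg⟩
  have hinj := Matrix.vecMul_injective_iff.mpr B.2
  have hgg : g' * g = 1 := by
    ext a b
    refine congrFun (hinj ?_) b
    change ((g' * g) * B.1) a = ((1 : Matrix (Fin d) (Fin d) K) * B.1) a
    rw [Matrix.mul_assoc, ← hg, ← hg', Matrix.one_mul]
  have := congrArg Matrix.det hgg
  simp [h0] at this

theorem Matrix.linearIndependent_row_of_submatrix {X : Matrix (Fin d) (Fin n) K}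
    {f : Fin d → Fin n} (h : (X.submatrix id f).det ≠ 0) : LinearIndependent K X.row := by
  rw [← Matrix.vecMul_injective_iff]
  intro y z hyz
  have hinj := Matrix.vecMul_injective_of_isUnit ((Matrix.isUnit_iff_isUnit_det _).2 h.isUnit)
  refine hinj ?_
  ext c
  exact congrFun hyz (f c)

theorem Matrix.submatrix_mul_left {l : Type*} (g : Matrix (Fin d) (Fin d) K)
    (X : Matrix (Fin d) (Fin n) K) (f : l → Fin n) :
    (g * X).submatrix id f = g * X.submatrix id f := rfl

theorem linearIndependent_row_of_span_eq {W : Gr K d n} {E : Matrix (Fin d) (Fin n) K}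
    (h : Submodule.span K (Set.range E.row) = W.1) : LinearIndependent K E.row := by
  rw [linearIndependent_iff_card_eq_finrank_span, Fintype.card_fin, Set.finrank, h, W.2]

end RowSpan

/-! ### Bruhat cells and echelon forms -/

section BruhatCells

variable {K : Type*} [Field K] {d n : ℕ} {α : Type*} [LinearOrder α]

theorem glTranslate_coordinateSubspace (g : GL (Fin n) K) (i : Fin d ↪o Fin n) :
    glTranslate g (coordinateSubspace K i)
      = Submodule.span K (Set.range ((g.1.submatrix id i)ᵀ).row) := by
  rw [glTranslate, coordinateSubspace, Submodule.map_span, ← Set.range_comp]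
  congr 2
  ext a l
  simp [Matrix.row]

/-- The cells `P · [e_I]` for the groups `P` of matrices which are triangular with respect to some
order on the indices consist of the row spans of the matrices in echelon form. -/
theorem exists_glTranslate_iff {κ : Fin n → α} (hκ : Function.Injective κ) (i : Fin d ↪o Fin n)
    (W : Submodule K (Fin n → K)) :
    (∃ g : GL (Fin n) K, g.1.BlockTriangular κ ∧ W = glTranslate g (coordinateSubspace K i)) ↔
      ∃ E : Matrix (Fin d) (Fin n) K, Submodule.span K (Set.range E.row) = W ∧
        (∀ a l, κ (i a) < κ l → E a l = 0) ∧ ∀ a, E a (i a) ≠ 0 := by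
  constructor
  · rintro ⟨g, hg, rfl⟩
    refine ⟨(g.1.submatrix id i)ᵀ, (glTranslate_coordinateSubspace g i).symm,
      fun a l hal => hg hal, fun a => ?_⟩
    have hdet : g.1.det ≠ 0 := ((Matrix.isUnit_iff_isUnit_det _).1 g.isUnit).ne_zero
    exact (hg.det_ne_zero_iff hκ).1 hdet (i a)
  · rintro ⟨E, rfl, hE, hE'⟩
    classical
    -- The rows of `E` become the columns `i a`; filling up with unit vectors keeps the matrix
    -- triangular with nonzero diagonal.
    let M : Matrix (Fin n) (Fin n) K := Matrix.of fun l c =>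
      if h : ∃ a, i a = c then E h.choose l else if l = c then 1 else 0
    have hM : ∀ l a, M l (i a) = E a l := by
      intro l a
      have h : ∃ b, i b = i a := ⟨a, rfl⟩
      have h' : h.choose = a := i.injective h.choose_spec
      simp only [M, Matrix.of_apply, dif_pos h, h']
    have hM' : ∀ l c, (¬ ∃ a, i a = c) → M l c = if l = c then 1 else 0 := by
      intro l c h
      simp only [M, Matrix.of_apply, dif_neg h]
    have hT : M.BlockTriangular κ := by
      intro l c hlc
      by_cases h : ∃ a, i a = c
      · obtain ⟨a, rfl⟩ := h
        rw [hM]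
        exact hE a l hlc
      · rw [hM' l c h, if_neg]
        rintro rfl
        exact lt_irrefl _ hlc
    have hdet : M.det ≠ 0 := by
      rw [hT.det_ne_zero_iff hκ]
      intro c
      by_cases h : ∃ a, i a = c
      · obtain ⟨a, rfl⟩ := h
        rw [hM]
        exact hE' a
      · rw [hM' c c h]
        simp
    refine ⟨Matrix.GeneralLinearGroup.mkOfDetNeZero M hdet, hT, ?_⟩
    rw [glTranslate_coordinateSubspace]
    congr 2
    ext a l
    exact (hM l a).symm

theorem mem_bruhatCellPos_iff (i : Fin d ↪o Fin n) (W : Gr K d n) :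
    W ∈ bruhatCellPos K i ↔ ∃ E : Matrix (Fin d) (Fin n) K,
      Submodule.span K (Set.range E.row) = W.1 ∧
        (∀ a l, i a < l → E a l = 0) ∧ ∀ a, E a (i a) ≠ 0 :=
  exists_glTranslate_iff (κ := fun l : Fin n => l) Function.injective_id i W.1

theorem mem_bruhatCellNeg_iff (i : Fin d ↪o Fin n) (W : Gr K d n) :
    W ∈ bruhatCellNeg K i ↔ ∃ E : Matrix (Fin d) (Fin n) K,
      Submodule.span K (Set.range E.row) = W.1 ∧
        (∀ a l, l < i a → E a l = 0) ∧ ∀ a, E a (i a) ≠ 0 :=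
  exists_glTranslate_iff (κ := OrderDual.toDual) OrderDual.toDual.injective i W.1

end BruhatCells

/-! ### Normal forms of points of the stratum -/

section NormalForms

variable {K : Type*} [Field K] {d n : ℕ}

/-- The shape of a normal form of the matrices `X` with `[X]` in the stratum of `w`, where `j'`
stands for `j ∘ w⁻¹`: the submatrix `X_I` is invertible and upper triangular, and the submatrix of
the columns `j'` is lower unitriangular and triangular with respect to the order of `j'`. -/
structure IsEchelonPair (i j' : Fin d → Fin n) (X : Matrix (Fin d) (Fin n) K) : Prop where
  eq_zero_of_lt : ∀ a l, l < i a → X a l = 0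
  pivot_ne_zero : ∀ a, X a (i a) ≠ 0
  diag : ∀ a, X a (j' a) = 1
  eq_zero : ∀ a c, a < c ∨ j' c < j' a → X a (j' c) = 0

/-- The normal form of the matrices representing the points in the stratum of `w`. -/
structure IsNormalForm (i j' : Fin d → Fin n) (X : Matrix (Fin d) (Fin n) K) : Prop
    extends IsEchelonPair i j' X where
  factor : ∃ C : Matrix (Fin d) (Fin n) K,
    X = X.submatrix id j' * C ∧ ∀ c l, j' c < l → C c l = 0

theorem IsEchelonPair.blockTriangular {i j' : Fin d → Fin n} {X : Matrix (Fin d) (Fin n) K}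
    (hX : IsEchelonPair i j' X) :
    (X.submatrix id j').BlockTriangular (OrderDual.toDual : Fin d → (Fin d)ᵒᵈ) :=
  fun a c hac => hX.eq_zero a c (Or.inl hac)

theorem IsEchelonPair.det_eq_one {i j' : Fin d → Fin n} {X : Matrix (Fin d) (Fin n) K}
    (hX : IsEchelonPair i j' X) : (X.submatrix id j').det = 1 := by
  rw [hX.blockTriangular.det_of_injective OrderDual.toDual.injective]
  exact Finset.prod_eq_one fun a _ => hX.diag a

theorem det_submatrix_ne_zero_of_echelon {i : Fin d ↪o Fin n} {X : Matrix (Fin d) (Fin n) K}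
    (h : ∀ a l, l < i a → X a l = 0) (h' : ∀ a, X a (i a) ≠ 0) :
    (X.submatrix id i).det ≠ 0 := by
  have hT : (X.submatrix id i).BlockTriangular (fun a : Fin d => a) :=
    fun a c hac => h a _ (i.strictMono hac)
  exact (hT.det_ne_zero_iff Function.injective_id).2 h'

/-- Every invertible matrix which is triangular in some order of the indices is, up to an upper
triangular factor, lower unitriangular and triangular in the same order. -/
theorem exists_upper_mul_eq_lower {α : Type*} [LinearOrder α] {κ : Fin d → α}
    (hκ : Function.Injective κ) {g : Matrix (Fin d) (Fin d) K} (hg : g.BlockTriangular κ)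
    (hdet : g.det ≠ 0) :
    ∃ h : Matrix (Fin d) (Fin d) K, h.BlockTriangular (fun a : Fin d => a) ∧ h.det ≠ 0 ∧
      (∀ a c, a < c → (h * g) a c = 0) ∧ (∀ a, (h * g) a a = 1) ∧ (h * g).BlockTriangular κ := by
  -- Row `a` of `h` must be orthogonal to the columns `c > a` of `g`, pair to 1 with column `a`, and
  -- vanish before position `a`. These are the equations for row `a` of the inverse of `g` with its
  -- columns before `a` replaced by unit vectors. Triangularity in the order of `κ` survives the
  -- replacement and makes the matrix invertible.
  let M : Fin d → Matrix (Fin d) (Fin d) K := fun a => Matrix.of fun r c =>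
    if c < a then if r = c then 1 else 0 else g r c
  have hMT : ∀ a, (M a).BlockTriangular κ := by
    intro a r c hrc
    simp only [M, Matrix.of_apply]
    split_ifs with h1 h2
    · exact absurd hrc (by simp [h2])
    · rfl
    · exact hg hrc
  have hM : ∀ a, (M a).det ≠ 0 := by
    intro a
    rw [(hMT a).det_ne_zero_iff hκ]
    intro r
    simp only [M, Matrix.of_apply, if_true]
    split_ifs
    · exact one_ne_zero
    · exact (hg.det_ne_zero_iff hκ).1 hdet r
  let h : Matrix (Fin d) (Fin d) K := Matrix.of fun a e => (M a)⁻¹ a e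
  have hinv : ∀ a c, ∑ e, (M a)⁻¹ a e * M a e c = (1 : Matrix (Fin d) (Fin d) K) a c := by
    intro a c
    rw [← Matrix.mul_apply, Matrix.nonsing_inv_mul _ (hM a).isUnit]
  have hhg : ∀ a c, a ≤ c → (h * g) a c = (1 : Matrix (Fin d) (Fin d) K) a c := by
    intro a c hac
    rw [← hinv a c, Matrix.mul_apply]
    refine Finset.sum_congr rfl fun e _ => ?_
    simp [h, M, hac.not_gt]
  have hlow : ∀ a c, a < c → (h * g) a c = 0 := fun a c hac => by
    rw [hhg a c hac.le, Matrix.one_apply_ne hac.ne]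
  have hone : ∀ a, (h * g) a a = 1 := fun a => by rw [hhg a a le_rfl, Matrix.one_apply_eq]
  have hhT : h.BlockTriangular κ := fun a e hae => (hMT a).inv_of_det_ne_zero (hM a) hae
  refine ⟨h, fun a c hca => ?_, fun h0 => ?_, hlow, hone, hhT.mul hg⟩
  · have := hinv a c
    rw [Matrix.one_apply_ne (ne_of_gt hca)] at this
    simpa [h, M, show c < a from hca] using this
  · have hT : (h * g).BlockTriangular (OrderDual.toDual : Fin d → (Fin d)ᵒᵈ) :=
      fun a c hac => hlow a c hac
    have := (hT.det_ne_zero_iff OrderDual.toDual.injective).2 fun a => by simp [hone]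
    rw [Matrix.det_mul, h0, zero_mul] at this
    exact this rfl

theorem weylMatrix_mul_apply (w : Equiv.Perm (Fin d)) (M : Matrix (Fin d) (Fin d) K)
    (a b : Fin d) : (weylMatrix K w * M) a b = M (w.symm a) b := by
  rw [Matrix.mul_apply, Finset.sum_eq_single (w.symm a)]
  · simp [weylMatrix]
  · intro c _ hc
    have : a ≠ w c := fun h => hc (by simp [h])
    simp [weylMatrix, this]
  · simp

/-- An echelon representative `E` for `I` is multiplied by upper triangular matrices only, so it
stays in echelon form. The first one strips `b` from `E_I⁻¹ E_J = b w b'`, the second comes from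
`exists_upper_mul_eq_lower`. -/
theorem exists_isNormalForm_of_mem_deodharStratum {i j : Fin d ↪o Fin n}
    {w : Equiv.Perm (Fin d)} {W : Gr K d n} (hW : W ∈ deodharStratum K i j w) :
    ∃ X : FullRankMatrix K d n, rowSpan X = W ∧ IsNormalForm i (fun a => j (w.symm a)) X.1 := by
  obtain ⟨⟨hneg, hpos⟩, b, hb, b', hb', hA⟩ := hW
  obtain ⟨E, hEW, hE, hE'⟩ := (mem_bruhatCellNeg_iff i W).1 hneg
  obtain ⟨C, hCW, hC, hC'⟩ := (mem_bruhatCellPos_iff j W).1 hpos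
  have hEI := det_submatrix_ne_zero_of_echelon hE hE'
  have hEspan : rowSpan ⟨E, linearIndependent_row_of_span_eq hEW⟩ = W := Subtype.ext hEW
  rw [← hEspan, baseChange_rowSpan] at hA
  have hbdet : b.1.det ≠ 0 := ((Matrix.isUnit_iff_isUnit_det _).1 b.isUnit).ne_zero
  have hbdet' : b'.1.det ≠ 0 := ((Matrix.isUnit_iff_isUnit_det _).1 b'.isUnit).ne_zero
  have hbT : b.1.BlockTriangular (fun a : Fin d => a) := fun a c hac => hb a c hac
  have hEIT : (E.submatrix id i).BlockTriangular (fun a : Fin d => a) :=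
    fun a c hac => hE a _ (i.strictMono hac)
  set s₀ : Matrix (Fin d) (Fin d) K := b.1⁻¹ * (E.submatrix id i)⁻¹ with hs₀
  have hs₀T : s₀.BlockTriangular (fun a : Fin d => a) :=
    (hbT.inv_of_det_ne_zero hbdet).mul (hEIT.inv_of_det_ne_zero hEI)
  have hs₀det : s₀.det ≠ 0 := by
    rw [Matrix.det_mul, Matrix.det_nonsing_inv, Matrix.det_nonsing_inv, Ring.inverse_eq_inv']
    exact mul_ne_zero (inv_ne_zero hbdet) (inv_ne_zero hEI)
  have hs₀J : s₀ * E.submatrix id j = weylMatrix K w * b'.1 := by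
    rw [hs₀, Matrix.mul_assoc, hA, Matrix.mul_assoc, ← Matrix.mul_assoc,
      Matrix.nonsing_inv_mul _ hbdet.isUnit, Matrix.one_mul]
  set j' : Fin d → Fin n := fun a => j (w.symm a) with hj'
  set g : Matrix (Fin d) (Fin d) K := (s₀ * E).submatrix id j' with hg
  -- Reordering the columns by `w⁻¹` turns `w b'` into the conjugate `w b' w⁻¹`, which is triangular
  -- in the order of `j'`.
  have hgb : g = b'.1.submatrix w.symm w.symm := by
    ext a c
    have := congrFun (congrFun hs₀J a) (w.symm c)
    rw [weylMatrix_mul_apply] at this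
    exact this
  have hj'inj : Function.Injective j' := j.injective.comp w.symm.injective
  have hgT : g.BlockTriangular j' := by
    intro a c hac
    rw [hgb]
    exact hb' _ _ (j.lt_iff_lt.1 hac)
  have hgdet : g.det ≠ 0 := by
    rw [hgb, Matrix.det_submatrix_equiv_self]
    exact hbdet'
  obtain ⟨h, hhT, hhdet, hlow, hone, hvT⟩ := exists_upper_mul_eq_lower hj'inj hgT hgdet
  have hX0 : (h * s₀).BlockTriangular (fun a : Fin d => a) := hhT.mul hs₀T
  have hX0det : (h * s₀).det ≠ 0 := by
    rw [Matrix.det_mul]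
    exact mul_ne_zero hhdet hs₀det
  have hXspan : Submodule.span K (Set.range (h * s₀ * E).row) = W.1 := by
    rw [Matrix.span_row_mul hX0det, hEW]
  have hXJ : (h * s₀ * E).submatrix id j' = h * g := by
    rw [Matrix.mul_assoc, Matrix.submatrix_mul_left]
  refine ⟨⟨h * s₀ * E, linearIndependent_row_of_span_eq hXspan⟩, Subtype.ext hXspan,
    ⟨fun a l hl => ?_, fun a => ?_, fun a => ?_, fun a c hac => ?_⟩, ?_⟩
  · refine (Matrix.mul_apply (M := h * s₀) (N := E)).trans (Finset.sum_eq_zero fun e _ => ?_)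
    rcases lt_or_ge e a with hea | hae
    · rw [hX0 hea, zero_mul]
    · rw [hE e l (hl.trans_le (i.monotone hae)), mul_zero]
  · have hT : ((h * s₀) * E.submatrix id i).BlockTriangular (fun a : Fin d => a) := hX0.mul hEIT
    refine (hT.det_ne_zero_iff Function.injective_id).1 ?_ a
    rw [Matrix.det_mul]
    exact mul_ne_zero hX0det hEI
  · exact (congrFun (congrFun hXJ a) a).trans (hone a)
  · refine (congrFun (congrFun hXJ a) c).trans ?_
    rcases hac with hac | hac
    · exact hlow a c hac
    · exact hvT hac
  · have hCspan : Submodule.span K (Set.range (C.submatrix w.symm id).row) = W.1 := by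
      rw [← hCW]
      congr 1
      exact w.symm.surjective.range_comp C.row
    obtain ⟨g', hg'⟩ := Matrix.exists_mul_of_span_row_le (hXspan.trans hCspan.symm).le
    set C₁ : Matrix (Fin d) (Fin n) K := C.submatrix w.symm id
    have hC₁ : ∀ c l, j' c < l → C₁ c l = 0 := fun c l hcl => hC _ _ hcl
    have hsT : (C₁.submatrix id j').BlockTriangular (fun a => OrderDual.toDual (j' a)) :=
      fun a c hac => hC₁ a _ hac
    have hsdet : (C₁.submatrix id j').det ≠ 0 :=
      (hsT.det_ne_zero_iff (OrderDual.toDual.injective.comp hj'inj)).2 fun a => hC' _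
    -- From `X = g' * C₁` the columns `j'` of `X` are `g'` times those of `C₁`, and eliminating `g'`
    -- gives the factorization.
    refine ⟨(C₁.submatrix id j')⁻¹ * C₁, ?_, fun c l hcl => ?_⟩
    · dsimp only
      rw [hg', Matrix.submatrix_mul_left, Matrix.mul_assoc,
        ← Matrix.mul_assoc (_ : Matrix _ _ K) _ C₁, Matrix.mul_nonsing_inv _ hsdet.isUnit, Matrix.one_mul]
    · rw [Matrix.mul_apply]
      refine Finset.sum_eq_zero fun e _ => ?_
      rcases lt_or_ge (j' e) l with hel | hle
      · rw [hC₁ e l hel, mul_zero]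
      · have := hsT.inv_of_det_ne_zero hsdet (i := c) (j := e) (hcl.trans_le hle)
        rw [this, zero_mul]

/-- `X` itself is an echelon form for `I`. Cancelling `v` in `v = v * C_{j'}` gives `C_{j'} = 1`, so
`C` with rows permuted by `w` is one for `J`. The base change is `X_I⁻¹ w (w⁻¹ v w)`, with both
outer factors upper triangular. -/
theorem IsNormalForm.mem_deodharStratum {i j : Fin d ↪o Fin n} {w : Equiv.Perm (Fin d)}
    {X : FullRankMatrix K d n} (hX : IsNormalForm i (fun a => j (w.symm a)) X.1) :
    rowSpan X ∈ deodharStratum K i j w := by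
  obtain ⟨C, hXC, hC⟩ := hX.factor
  have hvdet := hX.det_eq_one
  set v := X.1.submatrix id (fun a => j (w.symm a)) with hv
  have hXI := det_submatrix_ne_zero_of_echelon hX.eq_zero_of_lt hX.pivot_ne_zero
  have hCone : C.submatrix id (fun a => j (w.symm a)) = 1 := by
    have h1 : v = v * C.submatrix id (fun a => j (w.symm a)) := by
      rw [← Matrix.submatrix_mul_left, ← hXC]
    have h2 := congrArg (v⁻¹ * ·) h1
    rwa [← Matrix.mul_assoc, Matrix.nonsing_inv_mul _ (by simp [hvdet]), Matrix.one_mul,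
      eq_comm] at h2
  have hXIT : (X.1.submatrix id i).BlockTriangular (fun a : Fin d => a) :=
    fun a c hac => hX.eq_zero_of_lt a _ (i.strictMono hac)
  refine ⟨⟨(mem_bruhatCellNeg_iff i _).2 ⟨X.1, rfl, hX.eq_zero_of_lt, hX.pivot_ne_zero⟩,
    (mem_bruhatCellPos_iff j _).2 ⟨C.submatrix w id, ?_, fun a l hal => ?_, fun a => ?_⟩⟩, ?_⟩
  · change _ = Submodule.span K (Set.range X.1.row)
    rw [hXC, Matrix.span_row_mul (by simp [hvdet])]
    congr 1
    exact w.surjective.range_comp C.row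
  · exact hC _ _ (by simpa using hal)
  · have := congrFun (congrFun hCone (w a)) (w a)
    simp only [Matrix.submatrix_apply, id_eq, Equiv.symm_apply_apply, Matrix.one_apply_eq] at this
    simp [this]
  · rw [baseChange_rowSpan]
    have hinvdet : ((X.1.submatrix id i)⁻¹).det ≠ 0 := by
      rw [Matrix.det_nonsing_inv, Ring.inverse_eq_inv']
      exact inv_ne_zero hXI
    have hv'det : (v.submatrix w w).det ≠ 0 := by
      rw [Matrix.det_submatrix_equiv_self, hvdet]
      exact one_ne_zero
    refine ⟨Matrix.GeneralLinearGroup.mkOfDetNeZero _ hinvdet, fun a c hac =>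
      hXIT.inv_of_det_ne_zero hXI hac, Matrix.GeneralLinearGroup.mkOfDetNeZero _ hv'det,
      fun a c hac => hX.eq_zero _ _ (Or.inr (by simpa using hac)), ?_⟩
    rw [Matrix.mul_assoc]
    change _ = (X.1.submatrix id i)⁻¹ * (weylMatrix K w * v.submatrix w w)
    congr 1
    ext a c
    rw [weylMatrix_mul_apply]
    simp [hv]

/-- The columns `i c` for `c < a` and `j' c` for `c ≥ a`. -/
def mixedColumns (i j' : Fin d → Fin n) (a c : Fin d) : Fin n :=
  if c < a then i c else j' c

/-- The normal form of a matrix. -/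
noncomputable def normalForm (i j' : Fin d → Fin n) (Y : Matrix (Fin d) (Fin n) K) :
    Matrix (Fin d) (Fin n) K :=
  Matrix.of fun a l => ((Y.submatrix id (mixedColumns i j' a))⁻¹ * Y) a l

/-- The factor `g` cancels in each row, so the normal form depends only on the row span. -/
theorem normalForm_mul (i j' : Fin d → Fin n) {g : Matrix (Fin d) (Fin d) K} (hg : g.det ≠ 0)
    (Y : Matrix (Fin d) (Fin n) K) : normalForm i j' (g * Y) = normalForm i j' Y := by
  ext a l
  simp only [normalForm, Matrix.of_apply]
  rw [Matrix.submatrix_mul_left, Matrix.mul_inv_rev, Matrix.mul_assoc, ← Matrix.mul_assoc _ g,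
    Matrix.nonsing_inv_mul _ hg.isUnit, Matrix.one_mul]

theorem IsEchelonPair.det_mixedColumns_ne_zero {i : Fin d ↪o Fin n} {j' : Fin d → Fin n}
    {X : Matrix (Fin d) (Fin n) K} (hX : IsEchelonPair i j' X) (a : Fin d) :
    (X.submatrix id (mixedColumns i j' a)).det ≠ 0 := by
  -- This lists the indices below `a` increasingly, then the others decreasingly: the columns `i c`
  -- are upper triangular and the columns `j' c` lower triangular.
  let κ : Fin d → ℕ := fun r => if r < a then r else 2 * d - r
  have hκ : Function.Injective κ := by
    intro r c hrc
    simp only [κ] at hrc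
    have := a.2
    split_ifs at hrc <;> omega
  have hT : (X.submatrix id (mixedColumns i j' a)).BlockTriangular κ := by
    intro r c hrc
    simp only [κ] at hrc
    simp only [Matrix.submatrix_apply, id_eq, mixedColumns]
    by_cases hc : c < a
    · rw [if_pos hc]
      refine hX.eq_zero_of_lt _ _ (i.strictMono ?_)
      split_ifs at hrc <;> omega
    · rw [if_neg hc]
      refine hX.eq_zero _ _ (Or.inl ?_)
      split_ifs at hrc <;> omega
  rw [hT.det_ne_zero_iff hκ]
  intro r
  simp only [Matrix.submatrix_apply, id_eq, mixedColumns]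
  split_ifs
  · exact hX.pivot_ne_zero r
  · simp [hX.diag r]

/-- Among the mixed columns for `a`, row `a` of `X` is the unit vector `e_a`, since the columns `i
c` with `c < a` and `j' c` with `c > a` vanish there. Row `a` of `M * (M⁻¹ * X) = X` is thus row `a`
of `M⁻¹ * X`. -/
theorem IsEchelonPair.normalForm_eq {i : Fin d ↪o Fin n} {j' : Fin d → Fin n}
    {X : Matrix (Fin d) (Fin n) K} (hX : IsEchelonPair i j' X) : normalForm i j' X = X := by
  ext a l
  simp only [normalForm, Matrix.of_apply]
  set M := X.submatrix id (mixedColumns i j' a) with hM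
  have hrow : M a = Pi.single a 1 := by
    ext c
    simp only [hM, Matrix.submatrix_apply, id_eq, mixedColumns]
    rcases lt_trichotomy c a with hc | rfl | hc
    · rw [if_pos hc, Pi.single_eq_of_ne hc.ne]
      exact hX.eq_zero_of_lt _ _ (i.strictMono hc)
    · rw [if_neg (lt_irrefl _), Pi.single_eq_same]
      exact hX.diag c
    · rw [if_neg hc.not_gt, Pi.single_eq_of_ne hc.ne']
      exact hX.eq_zero _ _ (Or.inl hc)
  have h1 : (M * (M⁻¹ * X)) a l = X a l := by
    rw [← Matrix.mul_assoc, Matrix.mul_nonsing_inv _ (hX.det_mixedColumns_ne_zero a).isUnit,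
      Matrix.one_mul]
  refine Eq.trans ?_ h1
  rw [Matrix.mul_apply (M := M), hrow]
  simp [Pi.single_apply]

end NormalForms

/-! ### Completing a matrix by a linear system, over any commutative ring -/

section Completion

variable {R R' : Type*} [CommRing R] [CommRing R'] {d n : ℕ}

/-- The linear system for the coefficients of column `l` of a normal form. -/
def completionSystem (j' : Fin d → Fin n) (Y : Matrix (Fin d) (Fin n) R) (l : Fin n) :
    Matrix (Fin d) (Fin d) R :=
  Matrix.of fun a c => if l ≤ j' a then Y a (j' c) else if a = c then 1 else 0

/-- The coefficients of the columns of a normal form as combinations of the columns `j'`. -/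
def completionCoeff (j' : Fin d → Fin n) (Y : Matrix (Fin d) (Fin n) R) :
    Matrix (Fin d) (Fin n) R :=
  Matrix.of fun c l => ((completionSystem j' Y l).adjugate *ᵥ
    fun a => if l ≤ j' a then Y a l else 0) c

/-- The normal form with the entries of `Y` at the positions `(a, l)` with `l ≤ j' a` and in the
columns `j'`. -/
def completion (j' : Fin d → Fin n) (Y : Matrix (Fin d) (Fin n) R) : Matrix (Fin d) (Fin n) R :=
  Y.submatrix id j' * completionCoeff j' Y

theorem completionSystem_map (f : R →+* R') (j' : Fin d → Fin n) (Y : Matrix (Fin d) (Fin n) R)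
    (l : Fin n) : completionSystem j' (Y.map f) l = f.mapMatrix (completionSystem j' Y l) := by
  ext a c
  simp only [completionSystem, Matrix.of_apply, RingHom.mapMatrix_apply, Matrix.map_apply]
  split_ifs <;> simp

/-- Applied to the evaluation of a matrix of variables, this shows that the entries of a completion
are polynomials in the node values. It is the reason for using the adjugate instead of the inverse.
-/
theorem completion_map (f : R →+* R') (j' : Fin d → Fin n) (Y : Matrix (Fin d) (Fin n) R) :
    completion j' (Y.map f) = (completion j' Y).map f := by
  have hc : completionCoeff j' (Y.map f) = (completionCoeff j' Y).map f := by
    ext c l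
    simp only [completionCoeff, Matrix.of_apply, Matrix.map_apply, completionSystem_map,
      Matrix.mulVec, dotProduct, map_sum, map_mul]
    refine Finset.sum_congr rfl fun a _ => ?_
    rw [← RingHom.map_adjugate, RingHom.mapMatrix_apply, Matrix.map_apply]
    split_ifs <;> simp
  rw [completion, hc, completion, Matrix.map_mul]
  rfl

end Completion

/-! ### Completions are exactly the normal forms -/

section CompletionNormalForm

variable {K : Type*} [Field K] {d n : ℕ} {i j' : Fin d → Fin n} {Y : Matrix (Fin d) (Fin n) K}

/-- Replacing rows of a lower unitriangular matrix by unit vectors leaves it lower unitriangular. -/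
theorem IsEchelonPair.det_completionSystem (hY : IsEchelonPair i j' Y) (l : Fin n) :
    (completionSystem j' Y l).det = 1 := by
  have hT : (completionSystem j' Y l).BlockTriangular
      (OrderDual.toDual : Fin d → (Fin d)ᵒᵈ) := by
    intro a c hac
    have hac' : a < c := hac
    simp only [completionSystem, Matrix.of_apply, hac'.ne, if_false]
    rw [hY.eq_zero a c (Or.inl hac'), ite_self]
  rw [hT.det_of_injective OrderDual.toDual.injective]
  refine Finset.prod_eq_one fun a _ => ?_
  simp [completionSystem, hY.diag a]

/-- The coefficients are the unique solution of the linear system. -/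
theorem IsEchelonPair.completionCoeff_eq (hY : IsEchelonPair i j' Y) {l : Fin n} {x : Fin d → K}
    (hx : ∀ a, l ≤ j' a → ∑ c, Y a (j' c) * x c = Y a l) (hx' : ∀ a, j' a < l → x a = 0)
    (c : Fin d) : completionCoeff j' Y c l = x c := by
  have h : completionSystem j' Y l *ᵥ x = fun a => if l ≤ j' a then Y a l else 0 := by
    ext a
    simp only [completionSystem, Matrix.mulVec, dotProduct, Matrix.of_apply]
    split_ifs with hl
    · exact hx a hl
    · simp [hx' a (not_le.1 hl)]
  rw [completionCoeff, Matrix.of_apply, ← h, Matrix.mulVec_mulVec, Matrix.adjugate_mul,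
    hY.det_completionSystem, one_smul, Matrix.one_mulVec]

theorem IsEchelonPair.system_completionCoeff (hY : IsEchelonPair i j' Y) (a : Fin d) (l : Fin n) :
    ∑ c, completionSystem j' Y l a c * completionCoeff j' Y c l
      = if l ≤ j' a then Y a l else 0 := by
  have h : completionSystem j' Y l *ᵥ (fun c => completionCoeff j' Y c l)
      = fun a => if l ≤ j' a then Y a l else 0 := by
    change completionSystem j' Y l *ᵥ ((completionSystem j' Y l).adjugate *ᵥ _) = _
    rw [Matrix.mulVec_mulVec, Matrix.mul_adjugate, hY.det_completionSystem, one_smul,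
      Matrix.one_mulVec]
  exact congrFun h a

theorem IsEchelonPair.completionCoeff_eq_zero (hY : IsEchelonPair i j' Y) {a : Fin d} {l : Fin n}
    (h : j' a < l) : completionCoeff j' Y a l = 0 := by
  simpa [completionSystem, h.not_ge] using hY.system_completionCoeff a l

theorem IsEchelonPair.completion_apply (hY : IsEchelonPair i j' Y) {a : Fin d} {l : Fin n}
    (h : l ≤ j' a) : completion j' Y a l = Y a l := by
  simpa [completionSystem, h, completion, Matrix.mul_apply] using hY.system_completionCoeff a l

/-- For the column `l = j' e` the unit vector at `e` solves the system. -/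
theorem IsEchelonPair.completion_submatrix (hY : IsEchelonPair i j' Y) :
    (completion j' Y).submatrix id j' = Y.submatrix id j' := by
  have h : (completionCoeff j' Y).submatrix id j' = 1 := by
    ext c e
    rw [Matrix.submatrix_apply, id_eq, hY.completionCoeff_eq (x := fun c => if c = e then 1 else 0)]
    · rw [Matrix.one_apply]
    · simp
    · intro a ha
      rw [if_neg]
      rintro rfl
      exact lt_irrefl _ ha
  rw [completion, Matrix.submatrix_mul_left, h, Matrix.mul_one]

theorem IsEchelonPair.isNormalForm_completion (hY : IsEchelonPair i j' Y)
    (hij : ∀ a, i a ≤ j' a) : IsNormalForm i j' (completion j' Y) where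
  eq_zero_of_lt a l hl := by
    rw [hY.completion_apply (hl.le.trans (hij a)), hY.eq_zero_of_lt a l hl]
  pivot_ne_zero a := by
    rw [hY.completion_apply (hij a)]
    exact hY.pivot_ne_zero a
  diag a := (congrFun (congrFun hY.completion_submatrix a) a).trans (hY.diag a)
  eq_zero a c h := (congrFun (congrFun hY.completion_submatrix a) c).trans (hY.eq_zero a c h)
  factor := ⟨completionCoeff j' Y, by rw [hY.completion_submatrix, completion],
    fun _ _ h => hY.completionCoeff_eq_zero h⟩

theorem IsNormalForm.eq_completion {X : Matrix (Fin d) (Fin n) K} (hX : IsNormalForm i j' X)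
    (hY : IsEchelonPair i j' Y) (h : ∀ a l, l ≤ j' a → X a l = Y a l)
    (h' : ∀ a c, X a (j' c) = Y a (j' c)) : X = completion j' Y := by
  obtain ⟨C, hXC, hC⟩ := hX.factor
  have hXY : X.submatrix id j' = Y.submatrix id j' := by
    ext a c
    exact h' a c
  have hCY : completionCoeff j' Y = C := by
    ext c l
    refine hY.completionCoeff_eq (x := fun c => C c l) (fun a ha => ?_) (fun a ha => hC a l ha) c
    rw [← h a l ha]
    conv_rhs => rw [hXC, hXY, Matrix.mul_apply]
    rfl
  rw [completion, hCY, ← hXY, ← hXC]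

end CompletionNormalForm

/-! ### Nodes as the free entries of a normal form -/

section Nodes

variable {d n : ℕ} {i j : Fin d ↪o Fin n} {w : Equiv.Perm (Fin d)}

theorem mem_markedPoints_iff {a : Fin d} {l : Fin n} :
    (a, l) ∈ markedPoints j w ↔ l = j (w.symm a) := by
  constructor
  · rintro ⟨k, hk⟩
    obtain ⟨rfl, rfl⟩ := Prod.mk.inj hk
    simp
  · rintro rfl
    exact ⟨w.symm a, by simp⟩

theorem mem_gmNodes_iff {a : Fin d} {l : Fin n} :
    (a, l) ∈ gmNodes i j w ↔ l = j (w.symm a) ∧ i a ≠ l := by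
  rw [gmNodes, Set.mem_ofPred_eq, mem_markedPoints_iff]

theorem mem_affineNodes_iff {a : Fin d} {l : Fin n} :
    (a, l) ∈ affineNodes i j w ↔
      (i a < l ∧ l < j (w.symm a) ∧ ∀ c, l ≠ j (w.symm c)) ∨
      (i a ≤ l ∧ j (w.symm a) < l ∧ ∃ c, l = j (w.symm c) ∧ c < a) := by
  have hrange : l ∈ Set.range j ↔ ∃ c, l = j (w.symm c) :=
    ⟨fun ⟨k, hk⟩ => ⟨w k, by simp [hk]⟩, fun ⟨c, hc⟩ => ⟨_, hc.symm⟩⟩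
  simp only [affineNodes, Set.mem_union, Set.mem_ofPred_eq, mem_markedPoints_iff, exists_eq_left,
    hrange, not_exists]
  constructor
  · rintro (h | ⟨_, h1, h2, h3⟩)
    · exact Or.inl h
    · exact Or.inr ⟨h1, h3, h2⟩
  · rintro (h | ⟨h1, h3, c, h2⟩)
    · exact Or.inl h
    · exact Or.inr ⟨⟨c, h2.1⟩, h1, ⟨c, h2⟩, h3⟩

theorem strongMatchings_le (hw : w ∈ strongMatchings i j) (a : Fin d) : i a ≤ j (w.symm a) := by
  simpa using hw.1 (w.symm a)

theorem strongMatchings_eq (hw : w ∈ strongMatchings i j) {a c : Fin d}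
    (h : i a = j (w.symm c)) : a = c := by
  simpa using hw.2 a (w.symm c) h

open Classical in
/-- The matrix with given values at the nodes, where the value of the `𝔾ₘ`-node of row `a` is placed
at position `(a, i a)`, with ones at the marked points, and with zeros elsewhere. -/
noncomputable def nodeMatrix {R : Type*} [CommRing R] (i j : Fin d ↪o Fin n)
    (w : Equiv.Perm (Fin d)) (u : gmNodes i j w → R) (s : affineNodes i j w → R) :
    Matrix (Fin d) (Fin n) R :=
  Matrix.of fun a l =>
    if h : (a, l) ∈ affineNodes i j w then s ⟨_, h⟩
    else if h : (a, j (w.symm a)) ∈ gmNodes i j w ∧ l = i a then u ⟨_, h.1⟩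
    else if l = j (w.symm a) then 1 else 0

/-- The position of the matrix entry that belongs to a node. -/
def nodeEntry (i j : Fin d ↪o Fin n) (w : Equiv.Perm (Fin d)) :
    gmNodes i j w ⊕ affineNodes i j w → Fin d × Fin n :=
  Sum.elim (fun g => (g.1.1, i g.1.1)) (fun p => p.1)

theorem nodeMatrix_map {R R' : Type*} [CommRing R] [CommRing R'] (f : R →+* R')
    (u : gmNodes i j w → R) (s : affineNodes i j w → R) :
    (nodeMatrix i j w u s).map f = nodeMatrix i j w (fun g => f (u g)) (fun p => f (s p)) := by
  ext a l
  simp only [nodeMatrix, Matrix.map_apply, Matrix.of_apply]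
  split_ifs <;> simp

theorem not_mem_affineNodes_pivot (hw : w ∈ strongMatchings i j) (a : Fin d) :
    (a, i a) ∉ affineNodes i j w := by
  rw [mem_affineNodes_iff]
  rintro (⟨h, _⟩ | ⟨_, h, _⟩)
  · exact lt_irrefl _ h
  · exact absurd h (strongMatchings_le hw a).not_gt

theorem nodeMatrix_pivot {R : Type*} [CommRing R] (hw : w ∈ strongMatchings i j)
    (u : gmNodes i j w → R) (s : affineNodes i j w → R) (g : gmNodes i j w) :
    nodeMatrix i j w u s g.1.1 (i g.1.1) = u g := by
  obtain ⟨⟨a, l⟩, hg⟩ := g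
  obtain ⟨rfl, -⟩ := mem_gmNodes_iff.1 hg
  simp only [nodeMatrix, Matrix.of_apply]
  rw [dif_neg (not_mem_affineNodes_pivot hw a), dif_pos ⟨hg, rfl⟩]

theorem nodeMatrix_affine {R : Type*} [CommRing R]
    (u : gmNodes i j w → R) (s : affineNodes i j w → R) (p : affineNodes i j w) :
    nodeMatrix i j w u s p.1.1 p.1.2 = s p := by
  simp only [nodeMatrix, Matrix.of_apply]
  rw [dif_pos p.2]

variable {K : Type*} [Field K]

/-- Strong matching enters twice: `i a ≤ j' a` puts the marked point at or after the pivot, and `i a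
= j' c` only for `a = c` keeps the pivots away from the entries in columns `j'` that must vanish. If
`i a = j' a`, the pivot is the 1 at the marked point. -/
theorem isEchelonPair_nodeMatrix (hw : w ∈ strongMatchings i j) (u : gmNodes i j w → K)
    (hu : ∀ g, u g ≠ 0) (s : affineNodes i j w → K) :
    IsEchelonPair i (fun a => j (w.symm a)) (nodeMatrix i j w u s) where
  eq_zero_of_lt a l hl := by
    have h : (a, l) ∉ affineNodes i j w := by
      rw [mem_affineNodes_iff]
      rintro (⟨h, _⟩ | ⟨h, _⟩)
      · exact absurd h hl.not_gt
      · exact absurd h hl.not_ge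
    simp only [nodeMatrix, Matrix.of_apply]
    rw [dif_neg h, dif_neg fun h => hl.ne h.2,
      if_neg (hl.trans_le (strongMatchings_le hw a)).ne]
  pivot_ne_zero a := by
    by_cases hg : (a, j (w.symm a)) ∈ gmNodes i j w
    · rw [nodeMatrix_pivot hw u s ⟨_, hg⟩]
      exact hu _
    · have hia : i a = j (w.symm a) := by
        rw [mem_gmNodes_iff] at hg
        by_contra h
        exact hg ⟨rfl, h⟩
      simp only [nodeMatrix, Matrix.of_apply]
      rw [dif_neg (not_mem_affineNodes_pivot hw a), dif_neg fun h => hg h.1, if_pos hia]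
      exact one_ne_zero
  diag a := by
    have h : (a, j (w.symm a)) ∉ affineNodes i j w := by
      rw [mem_affineNodes_iff]
      rintro (⟨_, h, _⟩ | ⟨_, h, _⟩) <;> exact lt_irrefl _ h
    simp only [nodeMatrix, Matrix.of_apply]
    rw [dif_neg h, dif_neg fun h => (mem_gmNodes_iff.1 h.1).2 h.2.symm, if_pos trivial]
  eq_zero a c hac := by
    have hne : a ≠ c := by
      rintro rfl
      rcases hac with h | h <;> exact lt_irrefl _ h
    have h : (a, j (w.symm c)) ∉ affineNodes i j w := by
      rw [mem_affineNodes_iff]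
      rintro (⟨_, _, h⟩ | ⟨_, h, e, he, hea⟩)
      · exact h c rfl
      · obtain rfl : c = e := by simpa using he
        rcases hac with hac | hac
        · exact lt_asymm hac hea
        · exact lt_asymm hac h
    simp only [nodeMatrix, Matrix.of_apply]
    rw [dif_neg h, dif_neg fun h => hne (strongMatchings_eq hw h.2.symm), if_neg]
    simpa using hne.symm

/-- A normal form is determined by its entries belonging to the nodes. -/
theorem IsNormalForm.eq_completion_nodeMatrix (hw : w ∈ strongMatchings i j)
    {X : Matrix (Fin d) (Fin n) K} (hX : IsNormalForm i (fun a => j (w.symm a)) X) :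
    X = completion (fun a => j (w.symm a)) (nodeMatrix i j w (fun g => X g.1.1 (i g.1.1))
      (fun p => X p.1.1 p.1.2)) := by
  have hY := isEchelonPair_nodeMatrix hw (fun g => X g.1.1 (i g.1.1))
    (fun g => hX.pivot_ne_zero _) (fun p => X p.1.1 p.1.2)
  have hJ : ∀ a c, X a (j (w.symm c)) = nodeMatrix i j w (fun g => X g.1.1 (i g.1.1))
      (fun p => X p.1.1 p.1.2) a (j (w.symm c)) := by
    intro a c
    by_cases hn : (a, j (w.symm c)) ∈ affineNodes i j w
    · exact (nodeMatrix_affine _ (fun p => X p.1.1 p.1.2) ⟨_, hn⟩).symm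
    · rcases eq_or_ne a c with rfl | hac
      · rw [hX.diag, hY.diag]
      -- Off the diagonal, an entry not forced to vanish has `c < a` and `j' a < j' c`; then `i a ≤
      -- j' a < j' c`, so it is an affine node of the second type.
      · have h : a < c ∨ j (w.symm c) < j (w.symm a) := by
          by_contra! h
          refine hn (mem_affineNodes_iff.2 (Or.inr ⟨(strongMatchings_le hw a).trans h.2,
            lt_of_le_of_ne h.2 ?_, c, rfl, lt_of_le_of_ne h.1 hac.symm⟩))
          simpa using hac
        rw [hX.eq_zero a c h, hY.eq_zero a c h]
  refine hX.eq_completion hY (fun a l hl => ?_) hJ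
  by_cases hlJ : ∃ c, l = j (w.symm c)
  · obtain ⟨c, rfl⟩ := hlJ
    exact hJ a c
  · push Not at hlJ
    rcases lt_trichotomy l (i a) with h | rfl | h
    · rw [hX.eq_zero_of_lt a l h, hY.eq_zero_of_lt a l h]
    · exact (nodeMatrix_pivot hw (fun g => X g.1.1 (i g.1.1)) _
        ⟨(a, j (w.symm a)), mem_gmNodes_iff.2 ⟨rfl, hlJ a⟩⟩).symm
    · exact (nodeMatrix_affine _ (fun p => X p.1.1 p.1.2)
        ⟨(a, l), mem_affineNodes_iff.2 (Or.inl ⟨h, lt_of_le_of_ne hl (hlJ a), hlJ⟩)⟩).symm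

theorem completion_nodeMatrix_apply (hw : w ∈ strongMatchings i j) (u : gmNodes i j w → K)
    (hu : ∀ g, u g ≠ 0) (s : affineNodes i j w → K) (x : gmNodes i j w ⊕ affineNodes i j w) :
    completion (fun a => j (w.symm a)) (nodeMatrix i j w u s) (nodeEntry i j w x).1
      (nodeEntry i j w x).2 = Sum.elim u s x := by
  have hY := isEchelonPair_nodeMatrix hw u hu s
  rcases x with g | p
  · exact (hY.completion_apply (strongMatchings_le hw g.1.1)).trans (nodeMatrix_pivot hw u s g)
  · obtain ⟨⟨a, l⟩, hp⟩ := p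
    refine Eq.trans ?_ (nodeMatrix_affine u s ⟨_, hp⟩)
    rcases mem_affineNodes_iff.1 hp with ⟨_, h, _⟩ | ⟨_, _, c, rfl, _⟩
    · exact hY.completion_apply h.le
    · exact congrFun (congrFun hY.completion_submatrix a) c

end Nodes

/-! ### Rationality of the normal form -/

section Rationality

variable {k K : Type*} [Field k] [Field K] [Algebra k K] {d n : ℕ}

/-- The common denominator of the entries of the normal form. -/
def mixedDet {R : Type*} [CommRing R] (i j' : Fin d → Fin n) (Y : Matrix (Fin d) (Fin n) R) : R :=
  ∏ a, (Y.submatrix id (mixedColumns i j' a)).det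

theorem mixedDet_mul (i j' : Fin d → Fin n) (g : Matrix (Fin d) (Fin d) K)
    (Y : Matrix (Fin d) (Fin n) K) : mixedDet i j' (g * Y) = g.det ^ d * mixedDet i j' Y := by
  simp only [mixedDet, Matrix.submatrix_mul_left, Matrix.det_mul, Finset.prod_mul_distrib,
    Finset.prod_const, Finset.card_univ, Fintype.card_fin]

theorem aeval_mvPolynomialX_submatrix (f : Fin d → Fin n) (Y : Matrix (Fin d) (Fin n) K) :
    (MvPolynomial.aeval fun s : Fin d × Fin n => Y s.1 s.2).toRingHom.mapMatrix
      ((Matrix.mvPolynomialX (Fin d) (Fin n) k).submatrix id f) = Y.submatrix id f := by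
  ext a c
  simp [Matrix.mvPolynomialX]

theorem aeval_det_submatrix (f : Fin d → Fin n) (Y : Matrix (Fin d) (Fin n) K) :
    MvPolynomial.aeval (fun s : Fin d × Fin n => Y s.1 s.2)
      ((Matrix.mvPolynomialX (Fin d) (Fin n) k).submatrix id f).det
      = (Y.submatrix id f).det := by
  rw [← aeval_mvPolynomialX_submatrix (k := k) f Y, ← RingHom.map_det]
  rfl

theorem aeval_adjugate_submatrix (f : Fin d → Fin n) (Y : Matrix (Fin d) (Fin n) K)
    (a e : Fin d) :
    MvPolynomial.aeval (fun s : Fin d × Fin n => Y s.1 s.2)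
      (((Matrix.mvPolynomialX (Fin d) (Fin n) k).submatrix id f).adjugate a e)
      = (Y.submatrix id f).adjugate a e := by
  rw [← aeval_mvPolynomialX_submatrix (k := k) f Y, ← RingHom.map_adjugate]
  rfl

theorem aeval_mixedDet (i j' : Fin d → Fin n) (Y : Matrix (Fin d) (Fin n) K) :
    MvPolynomial.aeval (fun s : Fin d × Fin n => Y s.1 s.2)
      (mixedDet i j' (Matrix.mvPolynomialX (Fin d) (Fin n) k)) = mixedDet i j' Y := by
  simp only [mixedDet, map_prod, aeval_det_submatrix]

/-- By Cramer's rule row `a` needs only its own minor as denominator; the other factors of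
`mixedDet` are put into the numerator to have one denominator for all entries. -/
theorem exists_normalForm_eq_div (k : Type*) [Field k] [Algebra k K] (i j' : Fin d → Fin n)
    (a : Fin d) (l : Fin n) :
    ∃ p : MvPolynomial (Fin d × Fin n) k, ∀ Y : Matrix (Fin d) (Fin n) K, mixedDet i j' Y ≠ 0 →
      normalForm i j' Y a l
        = MvPolynomial.aeval (fun s : Fin d × Fin n => Y s.1 s.2) p / mixedDet i j' Y := by
  let G := Matrix.mvPolynomialX (Fin d) (Fin n) k
  refine ⟨(∏ c ∈ Finset.univ.erase a, (G.submatrix id (mixedColumns i j' c)).det) *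
    ∑ e, (G.submatrix id (mixedColumns i j' a)).adjugate a e * MvPolynomial.X (e, l),
    fun Y hY => ?_⟩
  simp only [G, map_mul, map_prod, map_sum, aeval_det_submatrix, aeval_adjugate_submatrix,
    MvPolynomial.aeval_X]
  have hQ : mixedDet i j' Y = (Y.submatrix id (mixedColumns i j' a)).det *
      ∏ c ∈ Finset.univ.erase a, (Y.submatrix id (mixedColumns i j' c)).det :=
    (Finset.mul_prod_erase _ _ (Finset.mem_univ a)).symm
  rw [hQ] at hY ⊢
  rw [mul_comm (_ : K) (∑ e, _), mul_div_mul_right _ _ (right_ne_zero_of_mul hY)]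
  simp only [normalForm, Matrix.of_apply, Matrix.inv_def, Ring.inverse_eq_inv', Matrix.smul_apply,
    smul_eq_mul, Matrix.mul_apply, mul_assoc]
  rw [← Finset.mul_sum, inv_mul_eq_div]

end Rationality

/-! ### The isomorphism -/

theorem mainTheorem8 (k K : Type*) [Field k] [Field K] [Algebra k K] [IsAlgClosed K]
    (d n : ℕ) (I J : Finset (Fin n)) (hI : I.card = d) (hJ : J.card = d)
    (w : Equiv.Perm (Fin d))
    (hw : w ∈ strongMatchings (I.orderEmbOfFin hI) (J.orderEmbOfFin hJ)) :
    ((grassmannian k K d n).restrict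
        (deodharStratum K (I.orderEmbOfFin hI) (J.orderEmbOfFin hJ) w)).Isomorphic
      (torusTimesAffine k K
        (gmNodes (I.orderEmbOfFin hI) (J.orderEmbOfFin hJ) w).ncard
        (affineNodes (I.orderEmbOfFin hI) (J.orderEmbOfFin hJ) w).ncard) := by
  generalize I.orderEmbOfFin hI = i at hw ⊢
  generalize J.orderEmbOfFin hJ = j at hw ⊢
  set α := (gmNodes i j w).ncard with hα
  set β := (affineNodes i j w).ncard with hβ
  let j' : Fin d → Fin n := fun a => j (w.symm a)
  let eg : gmNodes i j w ≃ Fin α := Finite.equivFinOfCardEq (Nat.card_coe_set_eq _)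
  let ea : affineNodes i j w ≃ Fin β := Finite.equivFinOfCardEq (Nat.card_coe_set_eq _)
  let T := (Fin α → Kˣ) × (Fin β → K)
  let c' : Fin α ⊕ Fin β → T → K :=
    Sum.elim (fun a x => ((x.1 a : Kˣ) : K)) (fun b x => x.2 b)
  let node : Fin α ⊕ Fin β → Fin d × Fin n :=
    fun x => nodeEntry i j w (Sum.map eg.symm ea.symm x)
  let Y : T → Matrix (Fin d) (Fin n) K := fun t =>
    nodeMatrix i j w (fun g => c' (Sum.inl (eg g)) t) (fun p => c' (Sum.inr (ea p)) t)
  have hY : ∀ t, IsEchelonPair i j' (Y t) := fun t =>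
    isEchelonPair_nodeMatrix hw _ (fun g => Units.ne_zero _) _
  have hX : ∀ t, IsNormalForm i j' (completion j' (Y t)) := fun t =>
    (hY t).isNormalForm_completion (strongMatchings_le hw)
  let ψ : T → FullRankMatrix K d n := fun t => ⟨completion j' (Y t),
    Matrix.linearIndependent_row_of_submatrix (f := j') (by simp [(hX t).det_eq_one])⟩
  -- The chosen representative is immaterial, as the normal form is invariant under `GL_d`.
  let F : Fin α ⊕ Fin β → Gr K d n → K := fun x W =>
    normalForm i j' (rowSpan_surjective W).choose.1 (node x).1 (node x).2
  have hrep : ∀ X : FullRankMatrix K d n, ∃ g : Matrix (Fin d) (Fin d) K, g.det ≠ 0 ∧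
      (rowSpan_surjective (rowSpan X)).choose.1 = g * X.1 := fun X =>
    exists_mul_of_rowSpan_eq (rowSpan_surjective (rowSpan X)).choose_spec
  have hF : ∀ x X, F x (rowSpan X) = normalForm i j' X.1 (node x).1 (node x).2 := by
    intro x X
    obtain ⟨g, hg, hgX⟩ := hrep X
    simp only [F, hgX, normalForm_mul i j' hg]
  have hFψ : ∀ x t, F x (rowSpan (ψ t)) = c' x t := by
    intro x t
    rw [hF, (hX t).normalForm_eq]
    refine (completion_nodeMatrix_apply hw _ (fun g => Units.ne_zero _) _ _).trans ?_
    rcases x with a | b <;> simp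
  let φ : T → deodharStratum K i j w := fun t =>
    ⟨rowSpan (ψ t), IsNormalForm.mem_deodharStratum (hX t)⟩
  have hφ : Function.Bijective φ := by
    constructor
    · intro t t' htt'
      have h : ∀ x, c' x t = c' x t' := fun x => by
        rw [← hFψ, ← hFψ, show rowSpan (ψ t) = rowSpan (ψ t') from congrArg Subtype.val htt']
      refine Prod.ext (funext fun a => Units.ext (h (Sum.inl a))) (funext fun b => h (Sum.inr b))
    · rintro ⟨W, hW⟩
      obtain ⟨X, rfl, hXn⟩ := exists_isNormalForm_of_mem_deodharStratum hW
      refine ⟨(fun a => Units.mk0 _ (hXn.pivot_ne_zero (eg.symm a).1.1),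
        fun b => X.1 (ea.symm b).1.1 (ea.symm b).1.2), Subtype.ext (congrArg rowSpan ?_)⟩
      refine Subtype.ext (Eq.trans ?_ (hXn.eq_completion_nodeMatrix hw).symm)
      simp [ψ, Y, c', j']
  refine SpaceWithFunctions.isomorphic_restrict_quotient _ c' rowSpan (deodharStratum K i j w)
    (Equiv.ofBijective φ hφ).symm ψ (fun t => rfl)
    (fun s => completion j' (nodeMatrix i j w (fun g => MvPolynomial.X (Sum.inl (eg g)))
      (fun p => MvPolynomial.X (Sum.inr (ea p)))) s.1 s.2) ?_ F ?_
    (mixedDet i j' (Matrix.mvPolynomialX (Fin d) (Fin n) k))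
    {W | mixedDet i j' (rowSpan_surjective W).choose.1 ≠ 0} ?_ ?_ ?_
  · intro s t
    have h := completion_map (MvPolynomial.aeval (R := k) fun u => c' u t).toRingHom j'
      (nodeMatrix i j w (fun g => MvPolynomial.X (Sum.inl (eg g)))
        (fun p => MvPolynomial.X (Sum.inr (ea p))))
    rw [nodeMatrix_map] at h
    simp only [AlgHom.toRingHom_eq_coe, RingHom.coe_coe, MvPolynomial.aeval_X] at h
    exact congrFun (congrFun h s.1) s.2
  · intro x W
    obtain ⟨t, rfl⟩ := hφ.2 W
    rw [Equiv.ofBijective_symm_apply_apply]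
    exact hFψ x t
  · intro X
    obtain ⟨g, hg, hgX⟩ := hrep X
    -- A change of representative multiplies `mixedDet` by the nonzero scalar `g.det ^ d`, so its
    -- nonvanishing is a condition on the row span.
    rw [aeval_mixedDet, Set.mem_ofPred_eq, hgX, mixedDet_mul]
    exact mul_ne_zero_iff_left (pow_ne_zero _ hg)
  · intro W hW
    obtain ⟨X, rfl, hXn⟩ := exists_isNormalForm_of_mem_deodharStratum hW
    obtain ⟨g, hg, hgX⟩ := hrep X
    rw [Set.mem_ofPred_eq, hgX, mixedDet_mul]
    exact mul_ne_zero (pow_ne_zero _ hg)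
      (Finset.prod_ne_zero_iff.2 fun a _ => hXn.det_mixedColumns_ne_zero a)
  · intro x
    obtain ⟨p, hp⟩ := exists_normalForm_eq_div (K := K) k i j' (node x).1 (node x).2
    refine ⟨p, 1, fun X hXQ => ?_⟩
    rw [aeval_mixedDet] at hXQ ⊢
    rw [hF, hp X.1 hXQ, pow_one]
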